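/- An oriented graph is a directed graph without loops and without pairs of opposite edges, and a tournament is an oriented graph in which any two distinct vertices are joined by exactly one edge. A directed graph $K$ contains a copy of $G$ if there is an injection $\phi:V(G)\to V(K)$ with $(\phi(u),\phi(v))\in E(K)$ for every $(u,v)\in E(G)$. For a tournament $K$ on $\mathbb{N}=\{0,1,2,\dots\}$, its forward density is $$d^+(K)=\liminf_{n\to\infty}\frac{|\{(i,j)\in E(K): 0\le i<j<n\}|}{\binom n2}.$$ For an oriented graph $G$, let $\overrightarrow{\rho}(G)$ be the smallest $\rho\in[0,1]$ such that every tournament $K$ on $\mathbb{N}$ with $d^+(K)>\rho$ contains a copy of $G$. Proposition. Let $P$ be the infinite forward directed path, that is, the oriented graph on $\mathbb{N}$ with edges $(i,i+1)$, $i\in\mathbb{N}$. Then $\overrightarrow{\rho}(P)=3/4$. That is, every tournament $K$ on $\mathbb{N}$ with $d^+(K)>3/4$ contains a copy of $P$, and no smaller number in $[0,1]$ has this property in place of $3/4$. -/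

import Mathlib

namespace ForwardDensity

/-- An oriented graph: no loops and no pair of opposite edges. -/
def IsOriented {V : Type*} (G : Digraph V) : Prop :=
  ∀ u v, G.Adj u v → ¬ G.Adj v u

/-- A tournament: an oriented graph in which any two distinct vertices are joined by an edge. -/
def IsTournament {V : Type*} (K : Digraph V) : Prop :=
  IsOriented K ∧ ∀ u v, u ≠ v → K.Adj u v ∨ K.Adj v u

/-- `K` contains a copy of `G`: some injection of the vertices maps edges to edges. -/
def ContainsCopy {V W : Type*} (K : Digraph W) (G : Digraph V) : Prop :=
  ∃ φ : V → W, Function.Injective φ ∧ ∀ u v, G.Adj u v → K.Adj (φ u) (φ v)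

/-- The number of forward edges of `K` among its first `n` vertices `0, …, n - 1`. -/
noncomputable def forwardEdgeCount (K : Digraph ℕ) (n : ℕ) : ℕ :=
  {p : ℕ × ℕ | p.1 < p.2 ∧ p.2 < n ∧ K.Adj p.1 p.2}.ncard

/-- The forward density of `K`: the lower limit of the proportion of forward edges
among the pairs of the first `n` vertices (the ratio lies in `[0, 1]` for every `n`). -/
noncomputable def forwardDensity (K : Digraph ℕ) : ℝ :=
  Filter.liminf (fun n : ℕ => (forwardEdgeCount K n : ℝ) / (n.choose 2 : ℝ)) Filter.atTop

/-- The `r ∈ [0, 1]` such that every tournament on `ℕ` of forward density greater than `r`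
contains a copy of `G`. -/
def forcingDensities {V : Type*} (G : Digraph V) : Set ℝ :=
  {r | r ∈ Set.Icc (0 : ℝ) 1 ∧
    ∀ K : Digraph ℕ, IsTournament K → r < forwardDensity K → ContainsCopy K G}

/-- The infinite forward directed path `0 → 1 → 2 → ⋯`. -/
def forwardPath : Digraph ℕ where
  Adj i j := j = i + 1

end ForwardDensity

namespace ForwardDensity

open Finset Filter

/-! Upper bound: suppose `K` has no ray. Keeping only edges `v → w` with `w ≤ M * (v + 1)` makes `K`
locally finite, so König's lemma (`exists_finite_closed_of_no_ray`) gives a finite closed `R`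
containing a long initial segment. Pairs `i < j` with `i ∈ R`, `j ∉ R` are then nearly all backward,
so density above 3/4 keeps this cut below `(1/8 - δ/2) n²`. Let `h` count the vertices below `n`
outside `R`. While `h ≤ n/2`, each new outside vertex adds `n - h ≥ h` to the cut, so the cut is at
least about `h²/2`; the bound then keeps `h` below `n/2` forever (`card_compl_le_of_cut_le`), which
is impossible for finite `R`.

Lower bound: orient edges so that they never raise a level function with finite sublevel sets; no
ray exists, and only ascending pairs are backward. In `slowLevel`, typical pairs of blocks use the
same two consecutive levels in nearly the same proportions `x`, `1 - x`, so about `x(1 - x) ≤ 1/4`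
of their pairs ascend (`four_mul_card_ascents_le`). -/

/-! ### Forward edge counts and density. -/

theorem sum_range_id_eq_choose_two (n : ℕ) : ∑ j ∈ range n, j = n.choose 2 := by
  rw [sum_range_id, Nat.choose_two_right]

open scoped Classical in
/-- Counting forward edges by their larger end. -/
theorem forwardEdgeCount_eq_sum (K : Digraph ℕ) (n : ℕ) :
    forwardEdgeCount K n = ∑ j ∈ range n, #{i ∈ range j | K.Adj i j} := by
  rw [forwardEdgeCount, ← Finset.card_sigma, ← Set.ncard_coe_finset]
  refine Set.ncard_congr (fun p _ => (⟨p.2, p.1⟩ : (_ : ℕ) × ℕ)) ?_ ?_ ?_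
  · rintro ⟨i, j⟩ ⟨h1, h2, h3⟩
    simpa using ⟨h2, h1, h3⟩
  · rintro ⟨i, j⟩ ⟨i', j'⟩ _ _ h
    simp only [Sigma.mk.injEq, heq_eq_eq] at h
    exact Prod.ext h.2 h.1
  · rintro ⟨j, i⟩ h
    have h' : j < n ∧ i < j ∧ K.Adj i j := by simpa using h
    exact ⟨(i, j), ⟨h'.2.1, h'.1, h'.2.2⟩, rfl⟩

theorem forwardEdgeCount_le (K : Digraph ℕ) (n : ℕ) : forwardEdgeCount K n ≤ n.choose 2 := by
  classical
  rw [forwardEdgeCount_eq_sum, ← sum_range_id_eq_choose_two]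
  exact Finset.sum_le_sum fun j _ => (card_filter_le _ _).trans (card_range j).le

theorem forwardRatio_mem_Icc (K : Digraph ℕ) (n : ℕ) :
    (forwardEdgeCount K n : ℝ) / (n.choose 2 : ℝ) ∈ Set.Icc (0 : ℝ) 1 :=
  ⟨by positivity, div_le_one_of_le₀ (by exact_mod_cast forwardEdgeCount_le K n) (by positivity)⟩

theorem eventually_mul_choose_le_of_lt_forwardDensity {K : Digraph ℕ} {r : ℝ}
    (h : r < forwardDensity K) :
    ∀ᶠ n : ℕ in atTop, r * (n.choose 2 : ℝ) ≤ forwardEdgeCount K n := by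
  have hb : IsBoundedUnder (· ≥ ·) atTop
      fun n : ℕ => (forwardEdgeCount K n : ℝ) / (n.choose 2 : ℝ) :=
    isBoundedUnder_of ⟨0, fun n => (forwardRatio_mem_Icc K n).1⟩
  filter_upwards [eventually_lt_of_lt_liminf h hb, eventually_ge_atTop 2] with n hn h2
  have : (0 : ℝ) < n.choose 2 := by exact_mod_cast Nat.choose_pos h2
  exact ((lt_div_iff₀ this).1 hn).le

theorem le_forwardDensity_of_eventually {K : Digraph ℕ} {r : ℝ}
    (h : ∀ᶠ n : ℕ in atTop, r * (n.choose 2 : ℝ) ≤ forwardEdgeCount K n) :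
    r ≤ forwardDensity K := by
  have hb : IsCoboundedUnder (· ≥ ·) atTop
      fun n : ℕ => (forwardEdgeCount K n : ℝ) / (n.choose 2 : ℝ) :=
    (isBoundedUnder_of ⟨1, fun n => (forwardRatio_mem_Icc K n).2⟩ :
      IsBoundedUnder (· ≤ ·) atTop _).isCoboundedUnder_ge
  refine le_liminf_of_le hb ?_
  filter_upwards [h, eventually_ge_atTop 2] with n hn h2
  have : (0 : ℝ) < n.choose 2 := by exact_mod_cast Nat.choose_pos h2
  exact (le_div_iff₀ this).2 hn

/-! ### König's lemma. -/

/-- The vertices within distance `d` of `S`. -/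
def reachBall {V : Type*} (E : V → V → Prop) (S : Set V) : ℕ → Set V
  | 0 => S
  | d + 1 => reachBall E S d ∪ ⋃ u ∈ reachBall E S d, {w | E u w}

theorem reachBall_finite {V : Type*} {E : V → V → Prop} (hE : ∀ v, {w | E v w}.Finite)
    {S : Set V} (hS : S.Finite) (d : ℕ) : (reachBall E S d).Finite := by
  induction d with
  | zero => exact hS
  | succ d ih => exact ih.union (ih.biUnion fun u _ => hE u)

/-- König's lemma: in a locally finite digraph without a ray, a finite set of vertices
lies in a finite set that no edge leaves. -/
theorem exists_finite_closed_of_no_ray {V : Type*} {E : V → V → Prop}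
    (hE : ∀ v, {w | E v w}.Finite)
    (hray : ¬ ∃ φ : ℕ → V, Function.Injective φ ∧ ∀ k, E (φ k) (φ (k + 1)))
    {S : Set V} (hS : S.Finite) :
    ∃ R : Set V, R.Finite ∧ S ⊆ R ∧ ∀ u ∈ R, ∀ w, E u w → w ∈ R := by
  classical
  set B := reachBall E S with hB
  have hmono : Monotone B := monotone_nat_of_le_succ fun d => Set.subset_union_left
  have hstep : ∀ d u w, u ∈ B d → E u w → w ∈ B (d + 1) := fun d u w hu huw =>
    Or.inr (Set.mem_biUnion hu huw)
  refine ⟨⋃ d, B d, ?_, Set.subset_iUnion B 0, ?_⟩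
  swap
  · intro u hu w huw
    obtain ⟨d, hd⟩ := Set.mem_iUnion.1 hu
    exact Set.mem_iUnion.2 ⟨d + 1, hstep d u w hd huw⟩
  by_contra hinf
  apply hray
  -- `T` keeps the edges that increase the distance from `S`, so a walk along `T` cannot repeat a
  -- vertex.
  let T : V → V → Prop := fun u w => E u w ∧ ∃ d, u ∈ B d ∧ w ∉ B d ∧ w ∈ B (d + 1)
  let Q : V → Set V := fun u => {w | Relation.ReflTransGen T u w}
  have hreach : ∀ d, ∀ w ∈ B d, ∃ u ∈ S, w ∈ Q u := by
    intro d
    induction d with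
    | zero => exact fun w hw => ⟨w, hw, Relation.ReflTransGen.refl⟩
    | succ d ih =>
      intro w hw
      by_cases hwd : w ∈ B d
      · exact ih w hwd
      rcases hw with hw | hw
      · exact absurd hw hwd
      obtain ⟨v, hv, hvw⟩ := Set.mem_iUnion₂.1 hw
      obtain ⟨u, hu, huv⟩ := ih v hv
      exact ⟨u, hu, Relation.ReflTransGen.tail huv ⟨hvw, d, hv, hwd, hstep d v w hv hvw⟩⟩
  have hstart : ∃ u, (Q u).Infinite := by
    by_contra! h
    refine hinf ((hS.biUnion fun u _ => h u).subset ?_)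
    intro w hw
    obtain ⟨d, hd⟩ := Set.mem_iUnion.1 hw
    obtain ⟨u, hu, hw⟩ := hreach d w hd
    exact Set.mem_biUnion hu hw
  have hnext : ∀ u : {u // (Q u).Infinite}, ∃ w : {u // (Q u).Infinite}, T u w := by
    rintro ⟨u, hu⟩
    by_contra! h
    refine hu (((((hE u).subset fun w (hw : T u w) => hw.1).biUnion
      fun w hw => Set.not_infinite.1 fun hw' => h ⟨w, hw'⟩ hw).insert u).subset ?_)
    intro w hw
    rcases Relation.ReflTransGen.cases_head hw with rfl | ⟨v, huv, hvw⟩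
    · exact Set.mem_insert _ _
    · exact Set.mem_insert_of_mem _ (Set.mem_biUnion (show v ∈ {w | T u w} from huv) hvw)
  choose f hf using hnext
  obtain ⟨u₀, hu₀⟩ := hstart
  let ψ : ℕ → {u // (Q u).Infinite} := fun k => f^[k] ⟨u₀, hu₀⟩
  have hψ : ∀ k, T (ψ k) (ψ (k + 1)) := fun k => by
    simp only [ψ, Function.iterate_succ_apply']
    exact hf _
  choose hψE d hd1 hd2 hd3 using hψ
  have hdlt : ∀ k, d k < d (k + 1) := fun k => by
    by_contra! h
    exact hd2 k (hmono h (hd1 (k + 1)))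
  have hdm : StrictMono d := strictMono_nat_of_lt_succ hdlt
  refine ⟨fun k => ψ k, Function.Injective.of_lt_imp_ne fun a b hab he => ?_, hψE⟩
  obtain ⟨c, rfl⟩ : ∃ c, b = c + 1 := ⟨b - 1, by omega⟩
  refine hd2 c ?_
  rw [← he]
  exact hmono (hdm.monotone (by omega)) (hd1 a)

/-! ### Density above 3/4 forces the path. -/

open scoped Classical in
/-- If forward edges leaving `R` more than multiply their starting point by `M`, then the pairs
of a vertex in `R` and a later vertex outside `R` are almost all backward edges. -/
theorem forwardEdgeCount_add_cut_le {K : Digraph ℕ} {R : Set ℕ} {M : ℕ} (hM : 0 < M)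
    (hR : ∀ u ∈ R, ∀ w, K.Adj u w → w ≤ M * (u + 1) → w ∈ R) (n : ℕ) :
    (forwardEdgeCount K n : ℝ) +
      ∑ j ∈ range n, (if j ∈ R then (0 : ℝ) else #{i ∈ range j | i ∈ R})
      ≤ (1 + 1 / M) * (n.choose 2 : ℝ) := by
  rw [forwardEdgeCount_eq_sum, ← sum_range_id_eq_choose_two]
  push_cast
  rw [← Finset.sum_add_distrib, Finset.mul_sum]
  refine Finset.sum_le_sum fun j _ => ?_
  have hMj : (0 : ℝ) ≤ 1 / M * j := by positivity
  have h1 : #{i ∈ range j | K.Adj i j} ≤ j := (card_filter_le _ _).trans (card_range j).le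
  have h1' : (#{i ∈ range j | K.Adj i j} : ℝ) ≤ j := by exact_mod_cast h1
  split_ifs with hj
  · linarith
  have h2 : #{i ∈ range j | K.Adj i j} + #{i ∈ range j | i ∈ R} ≤ j + j / M := by
    rw [← card_union_add_card_inter]
    refine add_le_add ((card_le_card (union_subset (filter_subset _ _)
      (filter_subset _ _))).trans (card_range j).le) ?_
    -- A forward edge from `i ∈ R` to `j ∉ R` must have `M * (i + 1) < j`.
    refine (card_le_card (t := range (j / M)) ?_).trans (card_range _).le
    intro i hi
    simp only [mem_inter, mem_filter, mem_range] at hi ⊢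
    have : M * (i + 1) < j := not_le.1 fun h => hj (hR i hi.2.2 j hi.1.2 h)
    rw [Nat.lt_iff_add_one_le, Nat.le_div_iff_mul_le hM]
    linarith
  have h3 : ((j / M : ℕ) : ℝ) ≤ (j : ℝ) / M := Nat.cast_div_le
  have h2' : (#{i ∈ range j | K.Adj i j} : ℝ) + #{i ∈ range j | i ∈ R} ≤ j + (j / M : ℕ) := by
    exact_mod_cast h2
  calc _ ≤ (j : ℝ) + (j : ℝ) / M := h2'.trans (by linarith)
    _ = _ := by ring

open scoped Classical in
/-- If `R` contains `0, …, n₀ - 1` and the cut between `R` and later vertices outside `R` stays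
below `(1/8 - δ/2) n²`, then at most half of the first `n` vertices lie outside `R`. -/
theorem card_compl_le_of_cut_le {R : Set ℕ} {δ : ℝ} (hδ : 0 < δ) {n₀ : ℕ}
    (hn₀ : 1 ≤ 2 * δ * n₀) (hR : ∀ i < n₀, i ∈ R)
    (hcut : ∀ n ≥ n₀, 2 * ∑ j ∈ range n, (if j ∈ R then (0 : ℝ) else #{i ∈ range j | i ∈ R})
      ≤ (1 / 4 - δ) * (n : ℝ) ^ 2) {n : ℕ} (hn : n₀ ≤ n) :
    (#{i ∈ range n | i ∉ R} : ℝ) ≤ n / 2 := by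
  set A : ℕ → ℝ := fun n => ∑ j ∈ range n, (if j ∈ R then (0 : ℝ) else #{i ∈ range j | i ∈ R})
  have hbound : ∀ n ≥ n₀, ∀ H : ℝ, 0 ≤ H → H ^ 2 ≤ 2 * A n → H ≤ n / 2 - δ * n := by
    intro n hn H hH h
    have h4 : 0 ≤ 1 / 4 - δ := by
      have h0 : 0 < n := by
        rcases Nat.eq_zero_or_pos n₀ with h0 | h0
        · subst h0; norm_num at hn₀
        · omega
      have : (0 : ℝ) < (n : ℝ) ^ 2 := by positivity
      by_contra! hneg
      nlinarith [hcut n hn, sq_nonneg H]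
    have hn0 : (0 : ℝ) ≤ n := by positivity
    refine le_of_sq_le_sq ?_ (by nlinarith)
    nlinarith [hcut n hn, mul_nonneg (sq_nonneg δ) (sq_nonneg (n : ℝ))]
  -- With `h` vertices outside, one more raises `h²` by `2h + 1` and `2 * A` by `2(n - h)`; `hbound`
  -- makes the former smaller.
  have key : ∀ n ≥ n₀, (#{i ∈ range n | i ∉ R} : ℝ) ^ 2 ≤ 2 * A n := by
    intro n hn
    induction n, hn using Nat.le_induction with
    | base =>
      have : #{i ∈ range n₀ | i ∉ R} = 0 := by
        rw [card_eq_zero, filter_eq_empty_iff]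
        exact fun i hi => not_not.2 (hR i (mem_range.1 hi))
      rw [this]
      have : 0 ≤ A n₀ := sum_nonneg fun j _ => by split_ifs <;> positivity
      simpa using this
    | succ n hn ih =>
      have hA : A (n + 1) = A n + if n ∈ R then (0 : ℝ) else #{i ∈ range n | i ∈ R} :=
        sum_range_succ _ _
      rw [hA, range_add_one, filter_insert]
      by_cases hnR : n ∈ R
      · simpa [hnR] using ih
      · have hb := hbound n hn _ (by positivity) ih
        have hsum : (#{i ∈ range n | i ∈ R} : ℝ) + #{i ∈ range n | i ∉ R} = n := by
          exact_mod_cast (card_filter_add_card_filter_not (s := range n) (· ∈ R)).trans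
            (card_range n)
        have hδn : 1 ≤ 2 * δ * n := hn₀.trans (by gcongr)
        simp only [hnR, not_false_eq_true, if_true, if_false]
        rw [card_insert_of_notMem (by simp)]
        push_cast
        nlinarith
  have := hbound n hn _ (by positivity) (key n hn)
  have : 0 ≤ δ * n := by positivity
  linarith

theorem containsCopy_forwardPath_of_lt_forwardDensity {K : Digraph ℕ}
    (hK : 3 / 4 < forwardDensity K) : ContainsCopy K forwardPath := by
  classical
  by_contra hno
  obtain ⟨r, hr, hrK⟩ := exists_between hK
  obtain ⟨N, hN⟩ := eventually_atTop.1 (eventually_mul_choose_le_of_lt_forwardDensity hrK)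
  -- Half of the excess over 3/4 absorbs the error `1 / (m + 1)`; the other half remains in `hcut`.
  set δ : ℝ := (r - 3 / 4) / 2 with hδdef
  have hδ : 0 < δ := by rw [hδdef]; linarith
  obtain ⟨m, hm⟩ := exists_nat_one_div_lt hδ
  obtain ⟨n₁, hn₁⟩ := exists_nat_gt (1 / (2 * δ))
  obtain ⟨R, hRfin, hSR, hR⟩ := exists_finite_closed_of_no_ray
    (E := fun v w => K.Adj v w ∧ w ≤ (m + 1) * (v + 1))
    (fun v => (Set.finite_Iic ((m + 1) * (v + 1))).subset fun w hw => hw.2)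
    (fun ⟨φ, hφ, h⟩ => hno ⟨φ, hφ, fun u v huv => by
      rw [show v = u + 1 from huv]; exact (h u).1⟩)
    (Set.finite_Iio (max N n₁))
  have hcut : ∀ n ≥ max N n₁,
      2 * ∑ j ∈ range n, (if j ∈ R then (0 : ℝ) else #{i ∈ range j | i ∈ R})
        ≤ (1 / 4 - δ) * (n : ℝ) ^ 2 := by
    intro n hn
    have h1 := forwardEdgeCount_add_cut_le (K := K) (Nat.succ_pos m)
      (fun u hu w huw hw => hR u hu w ⟨huw, hw⟩) n
    have h2 := hN n ((le_max_left _ _).trans hn)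
    have h3 : (0 : ℝ) ≤ n.choose 2 := by positivity
    have h4 : (n.choose 2 : ℝ) ≤ (n : ℝ) ^ 2 / 2 := by
      rw [Nat.cast_choose_two]; nlinarith [(Nat.cast_nonneg n : (0 : ℝ) ≤ n)]
    push_cast at h1
    have h5 : 0 ≤ ∑ j ∈ range n, (if j ∈ R then (0 : ℝ) else #{i ∈ range j | i ∈ R}) :=
      sum_nonneg fun j _ => by split_ifs <;> positivity
    have h6 : ∑ j ∈ range n, (if j ∈ R then (0 : ℝ) else #{i ∈ range j | i ∈ R})
        ≤ (1 / 4 - δ) * (n.choose 2 : ℝ) := by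
      have : (1 / ((m : ℝ) + 1)) * (n.choose 2 : ℝ) ≤ δ * n.choose 2 := by gcongr
      rw [hδdef] at this ⊢
      nlinarith
    rcases le_or_gt 0 (1 / 4 - δ) with h7 | h7
    · nlinarith
    -- This case is void: `r ≤ 1` gives `δ ≤ 1/8`.
    · have h8 : (0 : ℝ) = n.choose 2 := by nlinarith
      rw [← h8, mul_zero] at h6
      have h9 : n < 2 := by
        by_contra! h9
        exact (Nat.choose_pos h9).ne (by exact_mod_cast h8)
      have h10 : r ≤ 1 := by
        by_contra! h11
        have hk := hN (max N 2) (le_max_left _ _)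
        have hk' : ((forwardEdgeCount K (max N 2) : ℕ) : ℝ) ≤ (max N 2).choose 2 := by
          exact_mod_cast forwardEdgeCount_le K _
        have : (0 : ℝ) < (max N 2).choose 2 := by
          exact_mod_cast Nat.choose_pos (le_max_right _ _)
        nlinarith
      rw [hδdef] at h7
      linarith
  have hn₀ : (1 : ℝ) ≤ 2 * δ * (max N n₁ : ℕ) := by
    have h1 : (n₁ : ℝ) ≤ (max N n₁ : ℕ) := by exact_mod_cast le_max_right _ _
    rw [div_lt_iff₀ (by positivity)] at hn₁
    nlinarith
  have hhalf := fun n (hn : max N n₁ ≤ n) =>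
    card_compl_le_of_cut_le hδ hn₀ (fun i hi => hSR hi) hcut hn
  set c := #hRfin.toFinset
  -- At this length the at most `c` vertices of `R` are fewer than half.
  have h1 := hhalf (max N n₁ + 2 * c + 1) (by omega)
  have h2 := card_filter_add_card_filter_not (s := range (max N n₁ + 2 * c + 1)) (· ∈ R)
  have h3 : #{i ∈ range (max N n₁ + 2 * c + 1) | i ∈ R} ≤ c :=
    card_le_card fun i hi => hRfin.mem_toFinset.2 (mem_filter.1 hi).2
  rw [card_range] at h2
  rw [le_div_iff₀ (by norm_num)] at h1
  have h1' : #{i ∈ range (max N n₁ + 2 * c + 1) | i ∉ R} * 2 ≤ max N n₁ + 2 * c + 1 := by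
    exact_mod_cast h1
  omega

/-! ### Tournaments without the path, of density near 3/4. -/

/-- The tournament in which `i < j` is a forward edge exactly when `D j ≤ D i`. -/
def levelTournament (D : ℕ → ℕ) : Digraph ℕ where
  Adj i j := (i < j ∧ D j ≤ D i) ∨ (j < i ∧ D j < D i)

theorem isTournament_levelTournament (D : ℕ → ℕ) : IsTournament (levelTournament D) := by
  refine ⟨fun u v h h' => ?_, fun u v h => ?_⟩ <;> simp only [levelTournament] at * <;> omega

/-- Levels never rise along an edge, so a path would stay in one finite sublevel set. -/
theorem not_containsCopy_levelTournament {D : ℕ → ℕ} (hD : ∀ c, {i | D i ≤ c}.Finite) :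
    ¬ ContainsCopy (levelTournament D) forwardPath := by
  rintro ⟨φ, hφ, h⟩
  have hanti : Antitone (D ∘ φ) := antitone_nat_of_succ_le fun k => by
    have := h k (k + 1) rfl
    simp only [levelTournament, Function.comp] at *
    omega
  refine Set.infinite_range_of_injective hφ ((hD (D (φ 0))).subset ?_)
  rintro _ ⟨k, rfl⟩
  exact hanti (Nat.zero_le k)

/-- Levels that rise slowly, one residue class modulo `M` at a time. -/
def slowLevel (M i : ℕ) : ℕ := (Nat.log M (i / M) + i % M) / M

theorem finite_slowLevel_le {M : ℕ} (hM : 2 ≤ M) (c : ℕ) : {i | slowLevel M i ≤ c}.Finite := by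
  refine (Set.finite_Iio (M ^ (M * (c + 1)) * M)).subset fun i hi => ?_
  have hi' : (Nat.log M (i / M) + i % M) / M < c + 1 := Nat.lt_succ_of_le hi
  rw [Nat.div_lt_iff_lt_mul (by omega)] at hi'
  rw [Set.mem_Iio, ← Nat.div_lt_iff_lt_mul (by omega)]
  exact Nat.lt_pow_of_log_lt (by omega) (by linarith [Nat.zero_le (i % M), mul_comm M (c + 1)])

theorem slowLevel_mul_add {M r : ℕ} (b : ℕ) (hr : r < M) :
    slowLevel M (M * b + r) = (Nat.log M b + r) / M := by
  rw [slowLevel, Nat.mul_add_div (by omega), Nat.div_eq_of_lt hr, Nat.mul_add_mod,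
    Nat.mod_eq_of_lt hr, add_zero]

/-- Two blocks of length `M` whose logarithms differ by at most one
have about `M ^ 2 / 4` ascending pairs of levels. -/
theorem four_mul_card_ascents_le {M b b' : ℕ} (hM : 2 ≤ M) (hbb : b' ≤ M * b) :
    4 * #{p ∈ range M ×ˢ range M |
      slowLevel M (M * b + p.1) < slowLevel M (M * b' + p.2)} ≤ (M + 1) ^ 2 := by
  obtain ⟨g, hgb⟩ : ∃ g, Nat.log M b = g := ⟨_, rfl⟩
  have hg : Nat.log M b' ≤ g + 1 := by
    refine (Nat.log_mono_right hbb).trans ?_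
    rcases Nat.eq_zero_or_pos b with rfl | hb
    · simp
    · rw [mul_comm, Nat.log_mul_base (by omega) (by omega), hgb]
  -- In block `b`, residues below `M - t` have level `g / M` and the others the next level. As
  -- `Nat.log M b' ≤ g + 1`, an ascent needs `r < M - t` and `r' ≥ M - 1 - t`.
  set t := g % M
  have ht : t < M := Nat.mod_lt _ (by omega)
  have hgt : M * (g / M) + t = g := Nat.div_add_mod g M
  have hsub : {p ∈ range M ×ˢ range M |
      slowLevel M (M * b + p.1) < slowLevel M (M * b' + p.2)} ⊆
      range (M - t) ×ˢ Ico (M - 1 - t) M := by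
    rintro ⟨r, r'⟩ hp
    simp only [mem_filter, mem_product, mem_range, mem_Ico] at hp ⊢
    obtain ⟨⟨hr, hr'⟩, hlt⟩ := hp
    rw [slowLevel_mul_add b hr, slowLevel_mul_add b' hr', hgb] at hlt
    have h1 : (Nat.log M b' + r') / M < g / M + 2 := by
      rw [Nat.div_lt_iff_lt_mul (by omega)]
      nlinarith
    have h2 : g / M ≤ (g + r) / M := Nat.div_le_div_right (by omega)
    have h3 : (g + r) / M < g / M + 1 := by omega
    have h4 : g / M + 1 ≤ (Nat.log M b' + r') / M := by omega
    rw [Nat.div_lt_iff_lt_mul (by omega)] at h3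
    rw [Nat.le_div_iff_mul_le (by omega)] at h4
    have h5 : (g / M + 1) * M = M * (g / M) + M := by ring
    omega
  have hcard := card_le_card hsub
  rw [card_product, card_range, Nat.card_Ico] at hcard
  have h1 : M - (M - 1 - t) = t + 1 := by omega
  rw [h1] at hcard
  obtain ⟨s, hs⟩ : ∃ s, M = t + s := ⟨M - t, by omega⟩
  have h2 : M - t = s := by omega
  rw [h2] at hcard
  have h3 : 4 * (s * (t + 1)) ≤ (s + (t + 1)) ^ 2 := by
    zify; nlinarith [sq_nonneg ((s : ℤ) - (t + 1))]
  have h4 : M + 1 = s + (t + 1) := by omega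
  rw [h4]
  linarith

theorem sum_range_mul_eq_sum_sum (f : ℕ → ℕ) (M B : ℕ) :
    ∑ i ∈ range (M * B), f i = ∑ b ∈ range B, ∑ r ∈ range M, f (M * b + r) := by
  induction B with
  | zero => simp
  | succ B ih => rw [Nat.mul_succ, sum_range_add, ih, sum_range_succ]

/-- The ascending pairs of levels that end in a given block. -/
theorem four_mul_sum_ascents_le {M : ℕ} (hM : 2 ≤ M) (B : ℕ) :
    4 * ∑ r' ∈ range M, #{i ∈ range (M * B + r') | slowLevel M i < slowLevel M (M * B + r')}
      ≤ B * (M + 1) ^ 2 + 4 * M * B + 8 * M ^ 2 := by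
  have h1 : ∀ r' ∈ range M,
      #{i ∈ range (M * B + r') | slowLevel M i < slowLevel M (M * B + r')} ≤
      (∑ b ∈ range B, ∑ r ∈ range M,
        if slowLevel M (M * b + r) < slowLevel M (M * B + r') then 1 else 0) + M := by
    intro r' hr'
    rw [card_filter, sum_range_add,
      sum_range_mul_eq_sum_sum (fun i => if slowLevel M i < slowLevel M (M * B + r') then 1 else 0)]
    refine Nat.add_le_add_left ?_ _
    rw [← card_filter]
    exact (card_filter_le _ _).trans ((card_range r').le.trans (mem_range.1 hr').le)
  have h2 : ∀ b ∈ range B, 4 * ∑ r' ∈ range M, ∑ r ∈ range M,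
      (if slowLevel M (M * b + r) < slowLevel M (M * B + r') then 1 else 0) ≤
      (M + 1) ^ 2 + if M * b < B then 4 * M ^ 2 else 0 := by
    intro b _
    rw [sum_comm, ← sum_product (range M) (range M) (fun p : ℕ × ℕ =>
      if slowLevel M (M * b + p.1) < slowLevel M (M * B + p.2) then 1 else 0), ← card_filter]
    split_ifs with h
    · have := card_filter_le (range M ×ˢ range M)
        (fun p => slowLevel M (M * b + p.1) < slowLevel M (M * B + p.2))
      rw [card_product, card_range] at this
      nlinarith
    · exact four_mul_card_ascents_le hM (not_lt.1 h)
  -- Blocks too early for the logarithm comparison are a `1 / M` fraction, so the trivial bound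
  -- suffices for them.
  have h3 : #{b ∈ range B | M * b < B} ≤ B / M + 1 := by
    refine (card_le_card (t := range (B / M + 1)) fun b hb => ?_).trans (card_range _).le
    rw [mem_range, Nat.lt_succ_iff, Nat.le_div_iff_mul_le (by omega), mul_comm]
    exact (mem_filter.1 hb).2.le
  have h4 : M * (B / M) ≤ B := Nat.mul_div_le B M
  calc _ ≤ 4 * ∑ r' ∈ range M, ((∑ b ∈ range B, ∑ r ∈ range M,
        if slowLevel M (M * b + r) < slowLevel M (M * B + r') then 1 else 0) + M) :=
        Nat.mul_le_mul_left _ (sum_le_sum h1)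
    _ = ∑ b ∈ range B, 4 * ∑ r' ∈ range M, ∑ r ∈ range M,
        (if slowLevel M (M * b + r) < slowLevel M (M * B + r') then 1 else 0) + 4 * M ^ 2 := by
        rw [sum_add_distrib, sum_comm, ← mul_sum, sum_const, card_range, smul_eq_mul]; ring
    _ ≤ ∑ b ∈ range B, ((M + 1) ^ 2 + if M * b < B then 4 * M ^ 2 else 0) + 4 * M ^ 2 :=
        Nat.add_le_add_right (sum_le_sum h2) _
    _ = B * (M + 1) ^ 2 + #{b ∈ range B | M * b < B} * (4 * M ^ 2) + 4 * M ^ 2 := by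
        rw [sum_add_distrib, sum_const, card_range, smul_eq_mul, ← sum_filter, sum_const,
          smul_eq_mul]
    _ ≤ B * (M + 1) ^ 2 + (B / M + 1) * (4 * M ^ 2) + 4 * M ^ 2 := by gcongr
    _ ≤ _ := by nlinarith [Nat.mul_le_mul_left (4 * M) h4]

theorem eight_mul_sum_ascents_le {M : ℕ} (hM : 2 ≤ M) (B : ℕ) :
    8 * ∑ j ∈ range (M * B), #{i ∈ range j | slowLevel M i < slowLevel M j}
      ≤ B ^ 2 * ((M + 1) ^ 2 + 4 * M) + 16 * M ^ 2 * B := by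
  induction B with
  | zero => simp
  | succ B ih =>
    rw [Nat.mul_succ, sum_range_add]
    nlinarith [four_mul_sum_ascents_le hM B]

theorem forwardEdgeCount_levelTournament_add (D : ℕ → ℕ) (n : ℕ) :
    forwardEdgeCount (levelTournament D) n + ∑ j ∈ range n, #{i ∈ range j | D i < D j}
      = n.choose 2 := by
  classical
  rw [forwardEdgeCount_eq_sum, ← sum_add_distrib, ← sum_range_id_eq_choose_two]
  refine sum_congr rfl fun j _ => ?_
  have h : {i ∈ range j | (levelTournament D).Adj i j} = {i ∈ range j | ¬ D i < D j} := by
    refine filter_congr fun i hi => ?_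
    have := mem_range.1 hi
    simp only [levelTournament]
    omega
  rw [h, add_comm, card_filter_add_card_filter_not, card_range]

theorem eight_mul_sum_ascents_real_le {M : ℕ} (hM : 2 ≤ M) (n : ℕ) :
    8 * ((∑ j ∈ range n, #{i ∈ range j | slowLevel M i < slowLevel M j} : ℕ) : ℝ)
      ≤ (n + M : ℝ) ^ 2 * (1 + 7 / M) + 16 * M * (n + M) := by
  have hM0 : (2 : ℝ) ≤ M := by exact_mod_cast hM
  have hn : n ≤ M * (n / M + 1) := by
    have := Nat.div_add_mod n M
    have := Nat.mod_lt n (show 0 < M by omega)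
    linarith
  have h1 := (Nat.mul_le_mul_left 8 (sum_le_sum_of_subset (range_mono hn)
    (f := fun j => #{i ∈ range j | slowLevel M i < slowLevel M j}))).trans
      (eight_mul_sum_ascents_le hM (n / M + 1))
  have h2 : M * (n / M + 1) ≤ n + M := by linarith [Nat.mul_div_le n M]
  generalize n / M + 1 = B at h1 h2
  have h1' : 8 * ((∑ j ∈ range n, #{i ∈ range j | slowLevel M i < slowLevel M j} : ℕ) : ℝ)
      ≤ (B : ℝ) ^ 2 * ((M + 1 : ℝ) ^ 2 + 4 * M) + 16 * (M : ℝ) ^ 2 * B := by exact_mod_cast h1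
  have h2' : (M * B : ℝ) ≤ n + M := by exact_mod_cast h2
  calc _ ≤ (B : ℝ) ^ 2 * ((M + 1 : ℝ) ^ 2 + 4 * M) + 16 * (M : ℝ) ^ 2 * B := h1'
    _ ≤ (B : ℝ) ^ 2 * ((M : ℝ) ^ 2 + 7 * M) + 16 * (M : ℝ) ^ 2 * B := by
        gcongr ?_ * ?_ + _
        linarith [sq_nonneg (M : ℝ)]
    _ = (M * B : ℝ) ^ 2 * (1 + 7 / M) + 16 * M * (M * B) := by field_simp
    _ ≤ _ := by gcongr

theorem exists_levelTournament_forwardDensity_gt {r : ℝ} (hr : r < 3 / 4) :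
    ∃ M, 2 ≤ M ∧ r < forwardDensity (levelTournament (slowLevel M)) := by
  -- Taking `s > 0` ensures `δ < 3/4`, used in `h8`.
  obtain ⟨s, hs, hs'⟩ := exists_between (max_lt hr (show (0 : ℝ) < 3 / 4 by norm_num))
  obtain ⟨hrs, hs0⟩ := max_lt_iff.1 hs
  obtain ⟨δ, rfl⟩ : ∃ δ, s = 3 / 4 - δ := ⟨3 / 4 - s, by ring⟩
  have hδ : 0 < δ := by linarith
  obtain ⟨M₀, hM₀⟩ := exists_nat_gt (7 / δ)
  refine ⟨M₀ + 2, by omega, hrs.trans_le (le_forwardDensity_of_eventually ?_)⟩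
  obtain ⟨M, hMdef⟩ : ∃ M, M = M₀ + 2 := ⟨_, rfl⟩
  have hM : 2 ≤ M := by omega
  have hMr : (2 : ℝ) ≤ M := by exact_mod_cast hM
  have hMδ : 7 / (M : ℝ) ≤ δ := by
    rw [div_le_comm₀ (by positivity) hδ]
    refine hM₀.le.trans ?_
    rw [hMdef]; push_cast; linarith
  rw [← hMdef]
  -- The lower-order errors below total at most `40 * M * n`, which `δ * n²` then dominates.
  filter_upwards [tendsto_natCast_atTop_atTop.eventually_ge_atTop (41 * M / δ),
    eventually_ge_atTop M] with n hn hnM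
  have hnM' : (M : ℝ) ≤ n := by exact_mod_cast hnM
  rw [div_le_iff₀ hδ] at hn
  have h1 : (forwardEdgeCount (levelTournament (slowLevel M)) n : ℝ) +
      ((∑ j ∈ range n, #{i ∈ range j | slowLevel M i < slowLevel M j} : ℕ) : ℝ)
        = n.choose 2 := by
    exact_mod_cast forwardEdgeCount_levelTournament_add (slowLevel M) n
  have h2 := eight_mul_sum_ascents_real_le hM n
  have h3 : (n + M : ℝ) ^ 2 * (1 + 7 / M) ≤ (n + M : ℝ) ^ 2 * (1 + δ) := by gcongr
  have h4 : (n + M : ℝ) ^ 2 ≤ (n : ℝ) ^ 2 + 3 * M * n := by nlinarith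
  have h5 : (n + M : ℝ) ^ 2 * (1 + δ) ≤ ((n : ℝ) ^ 2 + 3 * M * n) * (1 + δ) := by gcongr
  have h6 : 41 * M * (n : ℝ) ≤ n * δ * n := by gcongr
  have h7 : 16 * (M : ℝ) * (n + M) ≤ 32 * (M * n) := by nlinarith
  have h8 : δ * (M * n) ≤ M * n := by
    have : (0 : ℝ) ≤ M * n := by positivity
    nlinarith
  have h9 : (n : ℝ) * (1 + 4 * δ) ≤ 2 * (M * n) := by
    nlinarith
  rw [Nat.cast_choose_two] at h1 ⊢
  nlinarith

end ForwardDensity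

theorem mainTheorem4 :
    IsLeast (ForwardDensity.forcingDensities ForwardDensity.forwardPath) (3 / 4 : ℝ) := by
  refine ⟨⟨⟨by norm_num, by norm_num⟩, fun K _ hK =>
    ForwardDensity.containsCopy_forwardPath_of_lt_forwardDensity hK⟩, fun r hr => ?_⟩
  by_contra! hlt
  obtain ⟨M, hM, hMr⟩ := ForwardDensity.exists_levelTournament_forwardDensity_gt hlt
  exact ForwardDensity.not_containsCopy_levelTournament
    (ForwardDensity.finite_slowLevel_le hM)
    (hr.2 _ (ForwardDensity.isTournament_levelTournament _) hMr)
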